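/- Let $d,n\ge 1$ and let $\mathcal S\subset\{0,1\}^d$ be almost symmetric of order $k\in\{1,\dots,d\}$, i.e. $\sum_{i=1}^d v_i\le k$ for all $v\in\mathcal S$ and $\mathrm{Conv}(\mathcal S)\cap[\frac{k}{2d},1]^d\ne\emptyset$. Put $\mathcal L=\max(\log(d/k),1)$. In each round $t=1,\dots,n$ of the semi-bandit game the forecaster draws an action $V_t\in\mathcal S$, while the adversary simultaneously (without knowing $V_t$, but possibly depending on the past and on its own randomization) selects a loss vector $\ell_t\in[0,\infty)^d$; the forecaster then observes only the coordinates $\ell_{i,t}$ with $V_{i,t}=1$. The regret is $$\overline R_n=\mathbb E\sum_{t=1}^n\ell_t^TV_t-\min_{v\in\mathcal S}\mathbb E\sum_{t=1}^n\ell_t^Tv .$$ For $\eta>0$ let $F(u)=\frac1\eta\sum_{i=1}^d u_i\log u_i$ on $[0,\infty)^d$ (with $0\log 0=0$) and $D_F(u,v)=F(u)-F(v)-(u-v)^T\nabla F(v)$. Semi-bandit linexp with parameter $\eta$ is the following forecaster. It starts from $w_1=\operatorname{argmin}_{w\in\mathrm{Conv}(\mathcal S)}D_F\big(w,(\frac kd,\dots,\frac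 kd)^T\big)$. In round $t$ it draws $V_t$ from a distribution $p_t$ on $\mathcal S$ (any choice depending on its past observations) with $\mathbb E_{V\sim p_t}V=w_t$, sets $\tilde\ell_{i,t}=\ell_{i,t}V_{i,t}/w_{i,t}$, lets $w'_{t+1}\in(0,\infty)^d$ satisfy $\nabla F(w'_{t+1})=\nabla F(w_t)-\tilde\ell_t$, and takes $w_{t+1}\in\operatorname{argmin}_{w\in\mathrm{Conv}(\mathcal S)\cap(0,\infty)^d}D_F(w,w'_{t+1})$. Then: - if $\|\ell_t\|_\infty\le 1$ for all $t$ ($L_\infty$ assumption), linexp with $\eta=\sqrt{\frac{2k\mathcal L}{nd}}$ satisfies $\overline R_n\le\sqrt{2knd\mathcal L}$; - if $\ell_t^Tv\le 1$ for all $t$ and all $v\in\mathcal S$ ($L_2$ assumption), linexp with $\eta=k\sqrt{\frac{\mathcal L}{nd}}$ satisfies $\overline R_n\le 2\sqrt{nd\mathcal L}$. -/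

import Mathlib

open MeasureTheory Finset
open scoped BigOperators Matrix

noncomputable section

/-! ### Almost symmetric action sets -/

/-- The finite set `S` of vectors is contained in `{0,1}^d` and is almost symmetric of order `k`:
`k ∈ {1,…,d}`, every action has at most `k` ones, and
`Conv(S) ∩ [k/(2d), 1]^d` is nonempty. -/
def IsAlmostSymmetric {d : ℕ} (S : Finset (Fin d → ℝ)) (k : ℕ) : Prop :=
  (∀ v ∈ S, ∀ i, v i = 0 ∨ v i = 1) ∧
  1 ≤ k ∧ k ≤ d ∧
  (∀ v ∈ S, ∑ i, v i ≤ (k : ℝ)) ∧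
  (convexHull ℝ (S : Set (Fin d → ℝ)) ∩
    {z | ∀ i, (k : ℝ) / (2 * (d : ℝ)) ≤ z i ∧ z i ≤ 1}).Nonempty

/-! ### The semi-bandit game

Rounds are numbered `0, 1, …, n - 1`. -/

/-- What the forecaster sees of the loss vector `l` in the semi-bandit game after playing `v`:
the coordinates `l i` with `v i = 1` (the other coordinates are replaced by `0`). -/
def semiBanditObs {d : ℕ} (l v : Fin d → ℝ) : Fin d → ℝ :=
  fun i => if v i = 1 then l i else 0

/-- The information available to the forecaster at the beginning of round `t`: for each earlier
round, the pair (action played, observed coordinates of the loss vector). -/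
abbrev SemiBanditHistory (d t : ℕ) : Type :=
  Fin t → (Fin d → ℝ) × (Fin d → ℝ)

/-- Histories that can occur in the semi-bandit game with action set `S` and nonnegative losses. -/
def IsAdmissibleHistory {d t : ℕ} (S : Finset (Fin d → ℝ)) (h : SemiBanditHistory d t) : Prop :=
  ∀ s, (h s).1 ∈ S ∧ ∃ l : Fin d → ℝ, (∀ i, 0 ≤ l i) ∧ (h s).2 = semiBanditObs l (h s).1

/-- A (randomized) forecaster for the semi-bandit game: to each round `t` and each history it
assigns a probability distribution `v ↦ prob t h v` on the action set `S`, measurably in the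
history. -/
structure SemiBanditForecaster {d : ℕ} (S : Finset (Fin d → ℝ)) where
  prob : (t : ℕ) → SemiBanditHistory d t → (Fin d → ℝ) → ℝ
  prob_nonneg : ∀ t h, ∀ v ∈ S, 0 ≤ prob t h v
  prob_sum : ∀ t h, ∑ v ∈ S, prob t h v = 1
  prob_measurable : ∀ t, ∀ v ∈ S, Measurable fun h => prob t h v

/-- The mean action `w_t = E_{V ∼ p_t} V` of the forecaster at round `t` after history `h`. -/
def SemiBanditForecaster.mean {d : ℕ} {S : Finset (Fin d → ℝ)} (σ : SemiBanditForecaster S)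
    (t : ℕ) (h : SemiBanditHistory d t) : Fin d → ℝ :=
  fun i => ∑ v ∈ S, σ.prob t h v * v i

/-- The history at the beginning of round `t` generated by the losses `ℓ` and the actions `V`. -/
def semiBanditHistory {d : ℕ} {Ω : Type*} (ℓ V : ℕ → Ω → Fin d → ℝ) (t : ℕ) (ω : Ω) :
    SemiBanditHistory d t :=
  fun s => (V s ω, semiBanditObs (ℓ s ω) (V s ω))

/-- The random losses `ℓ` and actions `V` are a play of `n` rounds of the semi-bandit game by the
forecaster `σ` against some (possibly randomized and adaptive) adversary. The σ-algebra `𝓖 t`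
contains everything that is determined before `V t` is drawn, including all the past and the loss
vector `ℓ t`, which the adversary selects without knowing `V t`; given `𝓖 t`, the action `V t` has
the law that the forecaster prescribes after the history that it has observed. -/
structure IsSemiBanditPlay {d : ℕ} {Ω : Type*} {mΩ : MeasurableSpace Ω} (P : Measure Ω)
    (𝓖 : Filtration ℕ mΩ) {S : Finset (Fin d → ℝ)} (σ : SemiBanditForecaster S) (n : ℕ)
    (ℓ V : ℕ → Ω → Fin d → ℝ) : Prop where
  loss_measurable : ∀ t < n, Measurable[𝓖 t] (ℓ t)
  loss_nonneg : ∀ t < n, ∀ ω i, 0 ≤ ℓ t ω i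
  action_measurable : ∀ t < n, Measurable[𝓖 (t + 1)] (V t)
  action_mem : ∀ t < n, ∀ ω, V t ω ∈ S
  action_law : ∀ t < n, ∀ v ∈ S,
    P[Set.indicator {ω | V t ω = v} (fun _ => (1 : ℝ)) | 𝓖 t]
      =ᵐ[P] fun ω => σ.prob t (semiBanditHistory ℓ V t ω) v

/-- The regret
`E ∑_t ℓ_tᵀ V_t - min_{v ∈ S} E ∑_t ℓ_tᵀ v` over `n` rounds. -/
def expectedRegret {d : ℕ} {Ω : Type*} {mΩ : MeasurableSpace Ω} (P : Measure Ω)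
    (S : Finset (Fin d → ℝ)) (n : ℕ) (ℓ V : ℕ → Ω → Fin d → ℝ) : ℝ :=
  (∫ ω, ∑ t ∈ range n, ℓ t ω ⬝ᵥ V t ω ∂P) -
    ⨅ v : {v // v ∈ S}, ∫ ω, ∑ t ∈ range n, ℓ t ω ⬝ᵥ (v : Fin d → ℝ) ∂P

/-- The `L_∞` assumption: `‖ℓ_t‖_∞ ≤ 1` in every round (the norm of `Fin d → ℝ` is the
sup norm). -/
def LInftyAssumption {d : ℕ} {Ω : Type*} (n : ℕ) (ℓ : ℕ → Ω → Fin d → ℝ) : Prop :=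
  ∀ t < n, ∀ ω, ‖ℓ t ω‖ ≤ 1

/-- The `L_2` assumption: `ℓ_tᵀ v ≤ 1` in every round, for every action `v ∈ S`. -/
def LTwoAssumption {d : ℕ} {Ω : Type*} (S : Finset (Fin d → ℝ)) (n : ℕ)
    (ℓ : ℕ → Ω → Fin d → ℝ) : Prop :=
  ∀ t < n, ∀ ω, ∀ v ∈ S, ℓ t ω ⬝ᵥ v ≤ 1

/-! ### CLEB and LINEXP -/

/-- The gradient of `F`, as the vector of its partial derivatives. -/
def grad {d : ℕ} (F : (Fin d → ℝ) → ℝ) (v : Fin d → ℝ) : Fin d → ℝ :=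
  fun i => fderiv ℝ F v (Pi.single i 1)

/-- The Bregman divergence `D_F(u, v) = F(u) - F(v) - (u - v)ᵀ ∇F(v)`. -/
def bregman {d : ℕ} (F : (Fin d → ℝ) → ℝ) (u v : Fin d → ℝ) : ℝ :=
  F u - F v - (u - v) ⬝ᵥ grad F v

/-- `w` is a minimizer of `f` over `A`, that is `w ∈ argmin_A f`. -/
def IsArgmin {E : Type*} (f : E → ℝ) (A : Set E) (w : E) : Prop :=
  w ∈ A ∧ ∀ u ∈ A, f w ≤ f u

/-- The semi-bandit loss estimate `ℓ̃_i = ℓ_i V_i / w_i`, computed from the action `r.1 = V`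
and the observed coordinates `r.2` of the loss vector `ℓ`. -/
def semiBanditEstimate {d : ℕ} (w : Fin d → ℝ) (r : (Fin d → ℝ) × (Fin d → ℝ)) : Fin d → ℝ :=
  fun i => r.2 i * (r.1 i / w i)

/-- The forecaster `σ` follows, during `n` rounds, the strategy CLEB (combinatorial learning with
Bregman projections) for the function `F` on the domain `D`, started from `w₁`, with the semi-bandit
loss estimate. Its distribution in the first round has mean `w₁`, and after an admissible
history its distribution has as mean a Bregman projection on `Conv(S) ∩ Int(D)` of a point
`w' ∈ Int(D)` with `∇F(w') = ∇F(w_t) - ℓ̃_t`. The choice of a distribution with the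
prescribed mean is free. -/
def IsSemiBanditCleb {d : ℕ} {S : Finset (Fin d → ℝ)} (F : (Fin d → ℝ) → ℝ)
    (D : Set (Fin d → ℝ)) (w₁ : Fin d → ℝ) (n : ℕ) (σ : SemiBanditForecaster S) : Prop :=
  (∀ h : SemiBanditHistory d 0, σ.mean 0 h = w₁) ∧
  ∀ t, t + 1 < n → ∀ h : SemiBanditHistory d (t + 1), IsAdmissibleHistory S h →
    ∃ w' ∈ interior D,
      grad F w' = grad F (σ.mean t (Fin.init h)) -
        semiBanditEstimate (σ.mean t (Fin.init h)) (h (Fin.last t)) ∧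
      IsArgmin (fun w => bregman F w w')
        (convexHull ℝ (S : Set (Fin d → ℝ)) ∩ interior D) (σ.mean (t + 1) h)

/-- The function `u ↦ (1/η) ∑ u_i log u_i` (with `0 log 0 = 0`). -/
def linexpPotential {d : ℕ} (η : ℝ) (u : Fin d → ℝ) : ℝ :=
  1 / η * ∑ i, u i * Real.log (u i)

/-- Semi-bandit LINEXP with parameter `η`, started from `w₁`: CLEB on `D = [0, ∞)^d` with the
function `(1/η) ∑ u_i log u_i`. -/
def IsSemiBanditLinexp {d : ℕ} {S : Finset (Fin d → ℝ)} (η : ℝ) (w₁ : Fin d → ℝ) (n : ℕ)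
    (σ : SemiBanditForecaster S) : Prop :=
  IsSemiBanditCleb (linexpPotential η) {u | ∀ i, 0 ≤ u i} w₁ n σ

end

/-!
Linexp is mirror descent on the importance-weighted losses `ℓ̃ₜ`. The three-point identity for
Bregman divergences, together with the Pythagorean inequality for the projection step, telescopes:
on every path `∑ ℓ̃ₜᵀ(wₜ - v) ≤ D_F(v, w₁) + ∑ D_F(wₜ, w'ₜ₊₁)`. Since `w'ₜ₊₁ = wₜ exp(-η ℓ̃ₜ)`
coordinatewise and `exp (-x) ≤ 1 - x + x² / 2` for `x ≥ 0`, the last term is at most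
`η / 2 * ∑ᵢ wᵢₜ ℓ̃ᵢₜ²`. Given the past and `ℓₜ`, the estimate `ℓ̃ₜ` has mean `ℓₜ` and
`∑ᵢ wᵢₜ ℓ̃ᵢₜ²` has mean `∑ᵢ ℓᵢₜ²`, so the regret is at most `D_F(v, w₁) + η / 2 * ∑ E ∑ᵢ ℓᵢₜ²`.

As `w₁` projects `(k/d, …, k/d)`, the first term is at most `D_F(v, (k/d, …, k/d)) ≤ k𝓛 / η`. The
sum of squares is at most `d` under the `L_∞` assumption. Under the `L_2` assumption
`∑ᵢ ℓᵢ² vᵢ ≤ (ℓᵀv)² ≤ 1` for `v ∈ S`, and testing this on a point of `Conv(S)` with coordinates at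
least `k / (2d)` bounds the sum of squares by `2d / k`.
-/

open InformationTheory (klFun klFun_nonneg klFun_zero)
open scoped ENNReal Topology

section Bregman

variable {d : ℕ} {F : (Fin d → ℝ) → ℝ}

theorem dotProduct_grad (F : (Fin d → ℝ) → ℝ) (v x : Fin d → ℝ) :
    x ⬝ᵥ grad F v = fderiv ℝ F v x := by
  conv_rhs => rw [pi_eq_sum_univ' x, map_sum]
  simp only [dotProduct, grad, map_smul, smul_eq_mul]

theorem bregman_three_point (F : (Fin d → ℝ) → ℝ) (u w y : Fin d → ℝ) :
    bregman F u y = bregman F u w + bregman F w y + (u - w) ⬝ᵥ (grad F w - grad F y) := by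
  have hsplit : (u - y) ⬝ᵥ grad F y = (u - w) ⬝ᵥ grad F y + (w - y) ⬝ᵥ grad F y := by
    rw [← add_dotProduct, sub_add_sub_cancel]
  simp only [bregman, hsplit, dotProduct_sub]
  ring

theorem IsArgmin.dotProduct_grad_sub_nonneg {K : Set (Fin d → ℝ)} {u w y : Fin d → ℝ}
    (hw : IsArgmin (fun x => bregman F x y) K w) (hF : DifferentiableAt ℝ F w)
    (hu : openSegment ℝ w u ⊆ K) : 0 ≤ (u - w) ⬝ᵥ (grad F w - grad F y) := by
  have hlin : HasFDerivAt (fun x => (x - y) ⬝ᵥ grad F y) (fderiv ℝ F y) w := by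
    simp only [dotProduct_grad, map_sub]
    exact (fderiv ℝ F y).hasFDerivAt.sub_const _
  have hderiv : HasFDerivAt (fun x => bregman F x y) (fderiv ℝ F w - fderiv ℝ F y) w :=
    (hF.hasFDerivAt.sub_const _).sub hlin
  have hmin : IsLocalMinOn (fun x => bregman F x y) K w :=
    (isMinOn_iff.2 hw.2).localize
  have hvariational := hmin.hasFDerivWithinAt_nonneg hderiv.hasFDerivWithinAt
    (sub_mem_posTangentConeAt_of_openSegment_subset hu)
  simpa only [dotProduct_sub, dotProduct_grad, _root_.sub_apply] using hvariational

theorem IsArgmin.bregman_add_bregman_le {K : Set (Fin d → ℝ)} {u w y : Fin d → ℝ}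
    (hw : IsArgmin (fun x => bregman F x y) K w) (hF : DifferentiableAt ℝ F w)
    (hu : openSegment ℝ w u ⊆ K) : bregman F u w + bregman F w y ≤ bregman F u y := by
  have hvariational := hw.dotProduct_grad_sub_nonneg hF hu
  rw [bregman_three_point F u w y]
  linarith

theorem IsArgmin.dotProduct_grad_add_smul_sub_nonneg {K : Set (Fin d → ℝ)} {w y z : Fin d → ℝ}
    {s : ℝ} (hw : IsArgmin (fun x => bregman F x y) K w) (hs : 0 < s)
    (hmem : w + s • (z - w) ∈ K) (hnonneg : 0 ≤ bregman F w (w + s • (z - w))) :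
    0 ≤ (z - w) ⬝ᵥ (grad F (w + s • (z - w)) - grad F y) := by
  have hmin := hw.2 _ hmem
  have hthree := bregman_three_point F w (w + s • (z - w)) y
  rw [sub_add_cancel_left, neg_dotProduct, smul_dotProduct, smul_eq_mul] at hthree
  exact nonneg_of_mul_nonneg_right (by linarith) hs

theorem sum_dotProduct_sub_le_of_mirror_descent {u : Fin d → ℝ} {w w' l : ℕ → Fin d → ℝ} {n : ℕ}
    (hstep : ∀ t ≤ n, grad F (w' t) = grad F (w t) - l t)
    (hproj : ∀ t < n, bregman F u (w (t + 1)) ≤ bregman F u (w' t)) :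
    ∑ t ∈ range (n + 1), l t ⬝ᵥ (w t - u) ≤
      bregman F u (w 0) - bregman F u (w' n) + ∑ t ∈ range (n + 1), bregman F (w t) (w' t) := by
  have hround (t : ℕ) (ht : t ≤ n) :
      l t ⬝ᵥ (w t - u) = bregman F u (w t) - bregman F u (w' t) + bregman F (w t) (w' t) := by
    have hthree := bregman_three_point F u (w t) (w' t)
    rw [hstep t ht, sub_sub_cancel, dotProduct_comm, ← neg_sub, dotProduct_neg] at hthree
    linarith
  induction n with
  | zero => simpa using (hround 0 le_rfl).le
  | succ n ih =>
    rw [sum_range_succ, sum_range_succ _ (n + 1), hround (n + 1) le_rfl]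
    have hpast := ih (fun t ht => hstep t (by lia)) (fun t ht => hproj t (by lia))
      (fun t ht => hround t (by lia))
    have hnext := hproj n n.lt_succ_self
    linarith

end Bregman

theorem exp_neg_le_one_sub_add_sq {x : ℝ} (hx : 0 ≤ x) : Real.exp (-x) ≤ 1 - x + x ^ 2 / 2 := by
  have hpos : 0 < 1 - x + x ^ 2 / 2 := by nlinarith [sq_nonneg (x - 1)]
  rw [Real.exp_neg, inv_le_iff_one_le_mul₀ (Real.exp_pos x)]
  calc 1 ≤ (1 - x + x ^ 2 / 2) * (1 + x + x ^ 2 / 2) := by nlinarith [sq_nonneg (x ^ 2)]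
    _ ≤ (1 - x + x ^ 2 / 2) * Real.exp x := by gcongr; exact Real.quadratic_le_exp_of_nonneg hx

theorem interior_setOf_nonneg {ι : Type*} [Finite ι] :
    interior {u : ι → ℝ | ∀ i, 0 ≤ u i} = {u | ∀ i, 0 < u i} := by
  have horthant : {u : ι → ℝ | ∀ i, 0 ≤ u i} = Set.univ.pi fun _ => Set.Ici 0 := by
    ext u; simp [Pi.le_def]
  rw [horthant, interior_pi_set Set.finite_univ]
  ext u; simp

section Potential

variable {d : ℕ} {η : ℝ}

theorem hasFDerivAt_linexpPotential (η : ℝ) {v : Fin d → ℝ} (hv : ∀ i, v i ≠ 0) :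
    HasFDerivAt (linexpPotential η)
      ((1 / η) • ∑ i, (Real.log (v i) + 1) • ContinuousLinearMap.proj (R := ℝ) i) v := by
  refine (HasFDerivAt.fun_sum fun i _ => ?_).const_mul _
  have hcoord : HasFDerivAt (fun u : Fin d → ℝ => u i) (ContinuousLinearMap.proj (R := ℝ) i) v :=
    hasFDerivAt_apply i v
  exact (Real.hasDerivAt_mul_log (hv i)).comp_hasFDerivAt v hcoord

theorem grad_linexpPotential (η : ℝ) {v : Fin d → ℝ} (hv : ∀ i, v i ≠ 0) :
    grad (linexpPotential η) v = fun i => 1 / η * (Real.log (v i) + 1) := by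
  funext i
  simp [grad, (hasFDerivAt_linexpPotential η hv).fderiv, Pi.single_apply]

theorem bregman_linexpPotential (η : ℝ) (u : Fin d → ℝ) {v : Fin d → ℝ} (hv : ∀ i, v i ≠ 0) :
    bregman (linexpPotential η) u v = 1 / η * ∑ i, v i * klFun (u i / v i) := by
  simp only [bregman, grad_linexpPotential η hv, linexpPotential, dotProduct, Pi.sub_apply,
    mul_left_comm _ (1 / η), ← mul_sum, ← mul_sub, ← sum_sub_distrib]
  congr 1
  refine sum_congr rfl fun i _ => ?_
  rcases eq_or_ne (u i) 0 with hu | hu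
  · rw [hu, zero_div, klFun_zero]
    ring
  · rw [klFun, Real.log_div hu (hv i)]
    field_simp [hv i]
    ring

theorem bregman_linexpPotential_nonneg (hη : 0 ≤ η) {u v : Fin d → ℝ} (hu : ∀ i, 0 ≤ u i)
    (hv : ∀ i, 0 < v i) : 0 ≤ bregman (linexpPotential η) u v := by
  rw [bregman_linexpPotential η u fun i => (hv i).ne']
  exact mul_nonneg (one_div_nonneg.2 hη) <| sum_nonneg fun i _ =>
    mul_nonneg (hv i).le (klFun_nonneg (div_nonneg (hu i) (hv i).le))

/-- The point `w'` with `∇F(w') = ∇F(w) - l` for the potential `F = linexpPotential η`: the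
unprojected step of linexp from `w` on the loss estimate `l`. -/
noncomputable def expWeightsUpdate (η : ℝ) (w l : Fin d → ℝ) : Fin d → ℝ :=
  fun i => w i * Real.exp (-(η * l i))

theorem expWeightsUpdate_pos {w : Fin d → ℝ} (hw : ∀ i, 0 < w i) (l : Fin d → ℝ) (i : Fin d) :
    0 < expWeightsUpdate η w l i :=
  mul_pos (hw i) (Real.exp_pos _)

theorem grad_linexpPotential_eq_sub_iff (hη : η ≠ 0) {w w' : Fin d → ℝ} (l : Fin d → ℝ)
    (hw : ∀ i, 0 < w i) (hw' : ∀ i, 0 < w' i) :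
    grad (linexpPotential η) w' = grad (linexpPotential η) w - l ↔
      w' = expWeightsUpdate η w l := by
  rw [grad_linexpPotential η fun i => (hw i).ne', grad_linexpPotential η fun i => (hw' i).ne',
    funext_iff, funext_iff]
  refine forall_congr' fun i => ?_
  have hlog : Real.log (expWeightsUpdate η w l i) = Real.log (w i) - η * l i := by
    rw [expWeightsUpdate, Real.log_mul (hw i).ne' (Real.exp_ne_zero _), Real.log_exp,
      sub_eq_add_neg]
  rw [← Real.log_injOn_pos.eq_iff (hw' i) (expWeightsUpdate_pos hw l i), hlog, Pi.sub_apply]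
  field_simp
  constructor <;> intro h <;> linarith

theorem bregman_linexpPotential_expWeightsUpdate_le (hη : 0 < η) {w l : Fin d → ℝ}
    (hw : ∀ i, 0 < w i) (hl : ∀ i, 0 ≤ l i) :
    bregman (linexpPotential η) w (expWeightsUpdate η w l) ≤ η / 2 * ∑ i, w i * l i ^ 2 := by
  have hkl (i : Fin d) : expWeightsUpdate η w l i * klFun (w i / expWeightsUpdate η w l i) =
      w i * (η * l i + Real.exp (-(η * l i)) - 1) := by
    have hratio : w i / expWeightsUpdate η w l i = Real.exp (η * l i) := by
      rw [expWeightsUpdate, Real.exp_neg]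
      field_simp [(hw i).ne']
    rw [hratio, klFun, Real.log_exp, expWeightsUpdate, Real.exp_neg]
    field_simp
  rw [bregman_linexpPotential η w fun i => (expWeightsUpdate_pos hw l i).ne', mul_sum, mul_sum]
  refine sum_le_sum fun i _ => ?_
  rw [hkl i, one_div, inv_mul_le_iff₀ hη]
  calc w i * (η * l i + Real.exp (-(η * l i)) - 1)
      ≤ w i * ((η * l i) ^ 2 / 2) := by
        have hexp := exp_neg_le_one_sub_add_sq (mul_nonneg hη.le (hl i))
        gcongr
        · exact (hw i).le
        · linarith
    _ = η * (η / 2 * (w i * l i ^ 2)) := by ring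

theorem sum_dotProduct_sub_le_of_linexp (hη : 0 < η) {u : Fin d → ℝ} (hu : ∀ i, 0 ≤ u i)
    {w l : ℕ → Fin d → ℝ} {n : ℕ} (hn : 1 ≤ n) (hw : ∀ t < n, ∀ i, 0 < w t i)
    (hl : ∀ t < n, ∀ i, 0 ≤ l t i)
    (hproj : ∀ t, t + 1 < n → bregman (linexpPotential η) u (w (t + 1)) ≤
      bregman (linexpPotential η) u (expWeightsUpdate η (w t) (l t))) :
    ∑ t ∈ range n, l t ⬝ᵥ (w t - u) ≤
      bregman (linexpPotential η) u (w 0) + η / 2 * ∑ t ∈ range n, ∑ i, w t i * l t i ^ 2 := by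
  obtain ⟨m, rfl⟩ := Nat.exists_eq_add_of_le' hn
  have hpos (t : ℕ) (ht : t < m + 1) := expWeightsUpdate_pos (η := η) (hw t ht) (l t)
  have hmirror := sum_dotProduct_sub_le_of_mirror_descent (F := linexpPotential η) (u := u) (n := m)
    (fun t ht => (grad_linexpPotential_eq_sub_iff hη.ne' (l t) (hw t (by lia))
      (hpos t (by lia))).2 rfl) (fun t ht => hproj t (by lia))
  have hlast := bregman_linexpPotential_nonneg hη.le hu (hpos m m.lt_succ_self)
  have hsteps : ∑ t ∈ range (m + 1),
      bregman (linexpPotential η) (w t) (expWeightsUpdate η (w t) (l t)) ≤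
        ∑ t ∈ range (m + 1), η / 2 * ∑ i, w t i * l t i ^ 2 :=
    sum_le_sum fun t ht => bregman_linexpPotential_expWeightsUpdate_le hη
      (hw t (mem_range.1 ht)) (hl t (mem_range.1 ht))
  rw [← mul_sum] at hsteps
  linarith

end Potential

section Positivity

variable {d : ℕ} {η : ℝ} {w z : Fin d → ℝ} {s : ℝ}

theorem add_smul_sub_pos (hw : ∀ i, 0 ≤ w i) (hz : ∀ i, 0 < z i) (hs : 0 < s) (hs1 : s ≤ 1)
    (i : Fin d) : 0 < (w + s • (z - w)) i := by
  simp only [Pi.add_apply, Pi.smul_apply, Pi.sub_apply, smul_eq_mul]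
  nlinarith [mul_pos hs (hz i), mul_nonneg (sub_nonneg.2 hs1) (hw i)]

theorem sub_mul_log_add_smul_sub_le (hw : ∀ i, 0 ≤ w i) (hz : ∀ i, 0 < z i) (hs : 0 < s)
    (hs1 : s ≤ 1) (i : Fin d) :
    (z i - w i) * Real.log ((w + s • (z - w)) i) ≤ (z i - w i) * Real.log (z i) := by
  have hpos := add_smul_sub_pos hw hz hs hs1 i
  simp only [Pi.add_apply, Pi.smul_apply, Pi.sub_apply, smul_eq_mul] at hpos ⊢
  rcases le_total (w i) (z i) with hwz | hzw
  · exact mul_le_mul_of_nonneg_left (Real.log_le_log hpos (by nlinarith)) (sub_nonneg.2 hwz)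
  · exact mul_le_mul_of_nonpos_left (Real.log_le_log (hz i) (by nlinarith)) (sub_nonpos.2 hzw)

theorem dotProduct_grad_linexpPotential_le (hη : 0 < η) (hw : ∀ i, 0 ≤ w i) (hz : ∀ i, 0 < z i)
    {i : Fin d} (hwi : w i = 0) (hs : 0 < s) (hs1 : s ≤ 1) :
    (z - w) ⬝ᵥ grad (linexpPotential η) (w + s • (z - w)) ≤
      (z - w) ⬝ᵥ grad (linexpPotential η) z + z i / η * Real.log s := by
  have hpos := add_smul_sub_pos hw hz hs hs1
  rw [grad_linexpPotential η fun j => (hpos j).ne', grad_linexpPotential η fun j => (hz j).ne',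
    ← Fintype.sum_ite_eq' i fun j => z j / η * Real.log s, dotProduct, dotProduct,
    ← sum_add_distrib]
  refine sum_le_sum fun j _ => ?_
  rw [Pi.sub_apply]
  split_ifs with hj
  · subst hj
    simp only [Pi.add_apply, Pi.smul_apply, Pi.sub_apply, smul_eq_mul, hwi, zero_add, sub_zero]
    rw [Real.log_mul hs.ne' (hz j).ne']
    exact le_of_eq (by ring)
  · have hlog := mul_le_mul_of_nonneg_left (sub_mul_log_add_smul_sub_le hw hz hs hs1 j)
      (one_div_pos.2 hη).le
    linarith

/-- The slope of `x * log x` at `0` is `-∞`, so moving `w` towards `z` would decrease the divergence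
if a coordinate of `w` vanished. -/
theorem IsArgmin.pos_of_bregman_linexpPotential {K : Set (Fin d → ℝ)} {y : Fin d → ℝ}
    (hw : IsArgmin (fun u => bregman (linexpPotential η) u y) K w) (hη : 0 < η)
    (hK : Convex ℝ K) (hKnonneg : ∀ u ∈ K, ∀ i, 0 ≤ u i) (hzK : z ∈ K) (hz : ∀ i, 0 < z i)
    (i : Fin d) : 0 < w i := by
  have hwK := hKnonneg w hw.1
  refine (hwK i).lt_of_ne' fun hwi => ?_
  set C := (z - w) ⬝ᵥ (grad (linexpPotential η) z - grad (linexpPotential η) y) with hC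
  have hbound : ∀ s ∈ Set.Ioo (0 : ℝ) 1, 0 ≤ C + z i / η * Real.log s := fun s hs => by
    have hmem : w + s • (z - w) ∈ K := hK.add_smul_sub_mem hw.1 hzK ⟨hs.1.le, hs.2.le⟩
    have hgrad := hw.dotProduct_grad_add_smul_sub_nonneg hs.1 hmem
      (bregman_linexpPotential_nonneg hη.le hwK (add_smul_sub_pos hwK hz hs.1 hs.2.le))
    have hle := dotProduct_grad_linexpPotential_le hη hwK hz hwi hs.1 hs.2.le
    rw [dotProduct_sub] at hgrad hC
    linarith
  have hlim : Filter.Tendsto (fun s => C + z i / η * Real.log s) (𝓝[>] 0) Filter.atBot :=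
    Filter.tendsto_atBot_add_const_left _ C
      (Real.tendsto_log_nhdsGT_zero.const_mul_atBot (div_pos (hz i) hη))
  obtain ⟨s, hs, hlog⟩ := (Filter.Eventually.and (Ioo_mem_nhdsGT zero_lt_one)
    (hlim.eventually_lt_atBot 0)).exists
  exact (hbound s hs).not_gt hlog

end Positivity

theorem nonneg_of_eq_zero_or_eq_one {x : ℝ} (hx : x = 0 ∨ x = 1) : 0 ≤ x := by
  rcases hx with rfl | rfl <;> simp

section ConvexHull

variable {ι : Type*} {S : Set (ι → ℝ)} {z : ι → ℝ}

theorem nonneg_of_mem_convexHull (hS : ∀ v ∈ S, ∀ i, 0 ≤ v i) (hz : z ∈ convexHull ℝ S) (i : ι) :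
    0 ≤ z i :=
  convexHull_min (t := Set.Ici 0) (fun v hv => hS v hv) (convex_Ici 0) hz i

theorem dotProduct_le_of_mem_convexHull [Fintype ι] {l : ι → ℝ} {c : ℝ} (hS : ∀ v ∈ S, l ⬝ᵥ v ≤ c)
    (hz : z ∈ convexHull ℝ S) : l ⬝ᵥ z ≤ c :=
  convexHull_min (t := {u | l ⬝ᵥ u ≤ c}) hS
    (convex_halfSpace_le ⟨dotProduct_add l, fun a u => dotProduct_smul a l u⟩ c) hz

theorem sq_dotProduct_le_one_of_dotProduct_le_one [Fintype ι] {l v : ι → ℝ} (hl : ∀ i, 0 ≤ l i)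
    (hv : ∀ i, v i = 0 ∨ v i = 1) (h : l ⬝ᵥ v ≤ 1) : l ^ 2 ⬝ᵥ v ≤ 1 := by
  have hlv (i : ι) : 0 ≤ l i * v i := mul_nonneg (hl i) (nonneg_of_eq_zero_or_eq_one (hv i))
  calc l ^ 2 ⬝ᵥ v = ∑ i, (l i * v i) ^ 2 :=
        sum_congr rfl fun i _ => by rcases hv i with hi | hi <;> simp [hi]
    _ ≤ (l ⬝ᵥ v) ^ 2 := sum_sq_le_sq_sum_of_nonneg fun i _ => hlv i
    _ ≤ 1 := pow_le_one₀ (sum_nonneg fun i _ => hlv i) h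

end ConvexHull

section AlmostSymmetric

variable {d k : ℕ} {S : Finset (Fin d → ℝ)}

theorem bregman_linexpPotential_const_le {η : ℝ} (hη : 0 ≤ η) (hk : 1 ≤ k) (hkd : k ≤ d)
    {v : Fin d → ℝ} (hv : ∀ i, v i = 0 ∨ v i = 1) (hvk : ∑ i, v i ≤ k) :
    bregman (linexpPotential η) v (fun _ => k / d) ≤ k * max (Real.log (d / k)) 1 / η := by
  have hk0 : (0 : ℝ) < k := by exact_mod_cast hk
  have hd0 : (0 : ℝ) < d := by exact_mod_cast hk.trans hkd
  have hcoord (i : Fin d) :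
      (k / d : ℝ) * klFun (v i / (k / d)) = v i * (Real.log (d / k) - 1) + k / d := by
    rcases hv i with hi | hi
    · simp [hi, klFun_zero]
    · rw [hi, klFun, one_div_div]
      field_simp
      ring
  have hmax := mul_le_mul_of_nonneg_left
    (sub_le_sub_right (le_max_left (Real.log (d / k)) 1) 1)
    (sum_nonneg fun i (_ : i ∈ univ) => nonneg_of_eq_zero_or_eq_one (hv i))
  have hsize := mul_le_mul_of_nonneg_right hvk
    (sub_nonneg.2 (le_max_right (Real.log (d / k)) 1))
  rw [bregman_linexpPotential η v fun _ => (div_pos hk0 hd0).ne', one_div_mul_eq_div]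
  gcongr
  calc ∑ i, (k / d : ℝ) * klFun (v i / (k / d))
      = (∑ i, v i) * (Real.log (d / k) - 1) + k := by
        rw [sum_congr rfl fun i _ => hcoord i, sum_add_distrib, ← sum_mul, sum_const, card_univ,
          Fintype.card_fin, nsmul_eq_mul, mul_div_cancel₀ _ hd0.ne']
    _ ≤ k * max (Real.log (d / k)) 1 := by linarith

namespace IsAlmostSymmetric

theorem exists_mem_convexHull_pos (hS : IsAlmostSymmetric S k) :
    ∃ z ∈ convexHull ℝ (S : Set (Fin d → ℝ)), (∀ i, (k : ℝ) / (2 * d) ≤ z i) ∧ ∀ i, 0 < z i := by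
  obtain ⟨-, hk, hkd, -, z, hz, hzk⟩ := hS
  have hk0 : (0 : ℝ) < k := by exact_mod_cast hk
  have hd0 : (0 : ℝ) < d := by exact_mod_cast hk.trans hkd
  have hbound : (0 : ℝ) < k / (2 * d) := div_pos hk0 (mul_pos two_pos hd0)
  exact ⟨z, hz, fun i => (hzk i).1, fun i => hbound.trans_le (hzk i).1⟩

theorem convexHull_nonneg (hS : IsAlmostSymmetric S k) {w : Fin d → ℝ}
    (hw : w ∈ convexHull ℝ (S : Set (Fin d → ℝ))) : ∀ i, 0 ≤ w i :=
  nonneg_of_mem_convexHull (fun v hv i => nonneg_of_eq_zero_or_eq_one (hS.1 v hv i)) hw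

theorem sum_sq_loss_le (hS : IsAlmostSymmetric S k) {l : Fin d → ℝ} (hl : ∀ i, 0 ≤ l i)
    (h : ∀ v ∈ S, l ⬝ᵥ v ≤ 1) : ∑ i, l i ^ 2 ≤ 2 * d / k := by
  obtain ⟨z, hz, hzk, -⟩ := hS.exists_mem_convexHull_pos
  have hk0 : (0 : ℝ) < k := by exact_mod_cast hS.2.1
  have hd0 : (0 : ℝ) < d := by exact_mod_cast hS.2.1.trans hS.2.2.1
  have hsq : l ^ 2 ⬝ᵥ z ≤ 1 := dotProduct_le_of_mem_convexHull
    (fun v hv => sq_dotProduct_le_one_of_dotProduct_le_one hl (hS.1 v hv) (h v hv)) hz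
  rw [← inv_div, ← one_div, le_div_iff₀ (by positivity), sum_mul]
  exact (sum_le_sum fun i _ => mul_le_mul_of_nonneg_left (hzk i) (sq_nonneg (l i))).trans hsq

variable {η : ℝ} {w₁ : Fin d → ℝ}

theorem argmin_pos (hS : IsAlmostSymmetric S k) (hη : 0 < η) {y : Fin d → ℝ}
    (hw₁ : IsArgmin (fun w => bregman (linexpPotential η) w y)
      (convexHull ℝ (S : Set (Fin d → ℝ))) w₁) : ∀ i, 0 < w₁ i := by
  obtain ⟨z, hz, -, hzpos⟩ := hS.exists_mem_convexHull_pos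
  exact hw₁.pos_of_bregman_linexpPotential hη (convex_convexHull ℝ _)
    (fun u hu => hS.convexHull_nonneg hu) hz hzpos

theorem bregman_argmin_le (hS : IsAlmostSymmetric S k) (hη : 0 < η)
    (hw₁ : IsArgmin (fun w => bregman (linexpPotential η) w (fun _ => (k : ℝ) / (d : ℝ)))
      (convexHull ℝ (S : Set (Fin d → ℝ))) w₁) {v : Fin d → ℝ} (hv : v ∈ S) :
    bregman (linexpPotential η) v w₁ ≤ k * max (Real.log (d / k)) 1 / η := by
  have hw₁pos := hS.argmin_pos hη hw₁
  obtain ⟨h01, hk, hkd, hcard, -⟩ := hS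
  have hcenter (_ : Fin d) : (0 : ℝ) < k / d :=
    div_pos (by exact_mod_cast hk) (by exact_mod_cast hk.trans hkd)
  have hpyth := hw₁.bregman_add_bregman_le
    (hasFDerivAt_linexpPotential η fun i => (hw₁pos i).ne').differentiableAt
    ((convex_convexHull ℝ _).openSegment_subset hw₁.1 (subset_convexHull ℝ _ hv))
  have hnonneg := bregman_linexpPotential_nonneg hη.le (fun i => (hw₁pos i).le) hcenter
  have hradius := bregman_linexpPotential_const_le hη.le hk hkd (h01 v hv) (hcard v hv)
  linarith

end IsAlmostSymmetric

end AlmostSymmetric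

section ImportanceWeighting

variable {Ω : Type*} {m mΩ : MeasurableSpace Ω} {P : Measure Ω} {f g w : Ω → ℝ}

theorem lintegral_mul_condLExp (hm : m ≤ mΩ) [SigmaFinite (P.trim hm)] {X Y : Ω → ℝ≥0∞}
    (hX : AEMeasurable X P) (hY : Measurable[m] Y) :
    ∫⁻ ω, Y ω * P⁻[X|m] ω ∂P = ∫⁻ ω, Y ω * X ω ∂P := by
  have hYm : Measurable Y := hY.mono hm le_rfl
  have hdensity : (P.withDensity P⁻[X|m]).trim hm = (P.withDensity X).trim hm := by
    refine @Measure.ext _ m _ _ fun s hs => ?_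
    rw [trim_measurableSet_eq hm hs, trim_measurableSet_eq hm hs, withDensity_apply _ (hm s hs),
      withDensity_apply _ (hm s hs), setLIntegral_condLExp hm P X hs]
  have hlint := congrArg (fun ν => ∫⁻ ω, Y ω ∂ν) hdensity
  simp only [lintegral_trim hm hY] at hlint
  rw [lintegral_withDensity_eq_lintegral_mul₀ (measurable_condLExp' m P X).aemeasurable
    hYm.aemeasurable, lintegral_withDensity_eq_lintegral_mul₀ hX hYm.aemeasurable] at hlint
  simpa only [Pi.mul_apply, mul_comm] using hlint

/-- Importance weighting puts the unbounded factor `1 / P[f | m]` into `g`, so that `g * f` is not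
obviously integrable; the `ℝ≥0∞`-valued conditional expectation computes its `L¹` norm. -/
theorem integrable_mul_of_integrable_mul_condExp (hm : m ≤ mΩ) [SigmaFinite (P.trim hm)]
    (hf : Integrable f P) (hf0 : 0 ≤ᵐ[P] f) (hg : StronglyMeasurable[m] g)
    (hgf : Integrable (g * P[f | m]) P) : Integrable (g * f) P := by
  refine ⟨(hg.mono hm).aestronglyMeasurable.mul hf.1, ?_⟩
  have hcond : ∫⁻ ω, ‖(g * f) ω‖ₑ ∂P = ∫⁻ ω, ‖(g * P[f | m]) ω‖ₑ ∂P := by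
    simp only [Pi.mul_apply, enorm_mul]
    rw [← lintegral_mul_condLExp hm hf.1.enorm hg.enorm]
    refine lintegral_congr_ae ?_
    filter_upwards [condLExp_enorm m hf hf0] with ω hω
    rw [hω]
  rw [HasFiniteIntegral, hcond]
  exact hgf.2

theorem integrable_and_integral_mul_div_condExp (hm : m ≤ mΩ) [SigmaFinite (P.trim hm)]
    (hf : Integrable f P) (hf0 : 0 ≤ᵐ[P] f) (hw : P[f | m] =ᵐ[P] w) (hw0 : ∀ᵐ ω ∂P, w ω ≠ 0)
    (hg : StronglyMeasurable[m] g) (hgint : Integrable g P) :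
    Integrable (fun ω => g ω * (f ω / w ω)) P ∧ ∫ ω, g ω * (f ω / w ω) ∂P = ∫ ω, g ω ∂P := by
  have hquot : StronglyMeasurable[m] (g / P[f | m]) := by
    simpa only [div_eq_mul_inv] using hg.mul stronglyMeasurable_condExp.inv₀
  have hcancel : g / P[f | m] * P[f | m] =ᵐ[P] g := by
    filter_upwards [hw, hw0] with ω hω hω0
    exact div_mul_cancel₀ _ (hω ▸ hω0)
  have hcongr : g / P[f | m] * f =ᵐ[P] fun ω => g ω * (f ω / w ω) := by
    filter_upwards [hw] with ω hω
    rw [Pi.mul_apply, Pi.div_apply, hω, mul_div_left_comm, mul_comm]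
  have hint : Integrable (g / P[f | m] * f) P :=
    integrable_mul_of_integrable_mul_condExp hm hf hf0 hquot (hgint.congr hcancel.symm)
  refine ⟨hint.congr hcongr, ?_⟩
  calc ∫ ω, g ω * (f ω / w ω) ∂P = ∫ ω, (g / P[f | m] * f) ω ∂P := (integral_congr_ae hcongr).symm
    _ = ∫ ω, P[g / P[f | m] * f | m] ω ∂P := (integral_condExp hm).symm
    _ = ∫ ω, g ω ∂P := integral_congr_ae
        ((condExp_mul_of_stronglyMeasurable_left hquot hint hf).trans hcancel)

end ImportanceWeighting

section Play

variable {d n : ℕ} {S : Finset (Fin d → ℝ)} {σ : SemiBanditForecaster S} {η : ℝ}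
  {w₁ : Fin d → ℝ}

theorem semiBanditEstimate_semiBanditObs (w l : Fin d → ℝ) {v : Fin d → ℝ} {i : Fin d}
    (hv : v i = 0 ∨ v i = 1) :
    semiBanditEstimate w (v, semiBanditObs l v) i = l i * (v i / w i) := by
  rcases hv with h | h <;> simp [semiBanditEstimate, semiBanditObs, h]

theorem IsAdmissibleHistory.init {t : ℕ} {h : SemiBanditHistory d (t + 1)}
    (hh : IsAdmissibleHistory S h) : IsAdmissibleHistory S (Fin.init h) :=
  fun s => hh s.castSucc

namespace IsSemiBanditLinexp

theorem mean_pos (hσ : IsSemiBanditLinexp η w₁ n σ) (hw₁ : ∀ i, 0 < w₁ i) {t : ℕ} (ht : t < n)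
    {h : SemiBanditHistory d t} (hh : IsAdmissibleHistory S h) : ∀ i, 0 < σ.mean t h i := by
  cases t with
  | zero => rwa [hσ.1 h]
  | succ t =>
    obtain ⟨_, _, _, hargmin⟩ := hσ.2 t ht h hh
    rw [interior_setOf_nonneg] at hargmin
    exact hargmin.1.2

theorem bregman_mean_succ_le (hσ : IsSemiBanditLinexp η w₁ n σ) (hη : 0 < η)
    (hw₁ : ∀ i, 0 < w₁ i) {t : ℕ} (ht : t + 1 < n) {h : SemiBanditHistory d (t + 1)}
    (hh : IsAdmissibleHistory S h) {v : Fin d → ℝ} (hvS : v ∈ S) (hv : ∀ i, 0 ≤ v i) :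
    bregman (linexpPotential η) v (σ.mean (t + 1) h) ≤
      bregman (linexpPotential η) v (expWeightsUpdate η (σ.mean t (Fin.init h))
        (semiBanditEstimate (σ.mean t (Fin.init h)) (h (Fin.last t)))) := by
  have hw := hσ.mean_pos hw₁ ht hh
  obtain ⟨w', hw', hgrad, hargmin⟩ := hσ.2 t ht h hh
  rw [interior_setOf_nonneg] at hw' hargmin
  have hsegment : openSegment ℝ (σ.mean (t + 1) h) v ⊆
      convexHull ℝ (S : Set (Fin d → ℝ)) ∩ {u | ∀ i, 0 < u i} := by
    refine Set.subset_inter ((convex_convexHull ℝ _).openSegment_subset hargmin.1.1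
      (subset_convexHull ℝ _ hvS)) ?_
    rintro _ ⟨a, b, ha, hb, -, rfl⟩ i
    exact add_pos_of_pos_of_nonneg (mul_pos ha (hw i)) (mul_nonneg hb.le (hv i))
  have hpyth := hargmin.bregman_add_bregman_le
    (hasFDerivAt_linexpPotential η fun i => (hw i).ne').differentiableAt hsegment
  have hnonneg := bregman_linexpPotential_nonneg hη.le (fun i => (hw i).le) hw'
  rw [← (grad_linexpPotential_eq_sub_iff hη.ne' _ (hσ.mean_pos hw₁ (by lia) hh.init) hw').1 hgrad]
  linarith

end IsSemiBanditLinexp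

variable {Ω : Type*} {mΩ : MeasurableSpace Ω} {P : Measure Ω} {𝓖 : Filtration ℕ mΩ}
  {ℓ V : ℕ → Ω → Fin d → ℝ}

/-- The mean `w_t` of the law of the action `V_t`, as a random vector: the forecaster's mean action
in round `t` after the history generated by the play. -/
noncomputable def meanAction (σ : SemiBanditForecaster S) (ℓ V : ℕ → Ω → Fin d → ℝ) (t : ℕ)
    (ω : Ω) : Fin d → ℝ :=
  σ.mean t (semiBanditHistory ℓ V t ω)

/-- The estimate `ℓ̃_t` of the loss vector `ℓ_t`, as a random vector. -/
noncomputable def lossEstimate (σ : SemiBanditForecaster S) (ℓ V : ℕ → Ω → Fin d → ℝ) (t : ℕ)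
    (ω : Ω) : Fin d → ℝ :=
  semiBanditEstimate (meanAction σ ℓ V t ω) (V t ω, semiBanditObs (ℓ t ω) (V t ω))

namespace IsSemiBanditPlay

theorem isAdmissibleHistory (hplay : IsSemiBanditPlay P 𝓖 σ n ℓ V) {t : ℕ} (ht : t ≤ n) (ω : Ω) :
    IsAdmissibleHistory S (semiBanditHistory ℓ V t ω) := fun s =>
  ⟨hplay.action_mem s (s.2.trans_le ht) ω, ℓ s ω, hplay.loss_nonneg s (s.2.trans_le ht) ω, rfl⟩

theorem meanAction_pos (hplay : IsSemiBanditPlay P 𝓖 σ n ℓ V) (hσ : IsSemiBanditLinexp η w₁ n σ)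
    (hw₁ : ∀ i, 0 < w₁ i) {t : ℕ} (ht : t < n) (ω : Ω) : ∀ i, 0 < meanAction σ ℓ V t ω i :=
  hσ.mean_pos hw₁ ht (hplay.isAdmissibleHistory ht.le ω)

theorem measurable_action (hplay : IsSemiBanditPlay P 𝓖 σ n ℓ V) {t : ℕ} (ht : t < n) :
    Measurable (V t) :=
  (hplay.action_measurable t ht).mono (𝓖.le (t + 1)) le_rfl

theorem condExp_action [IsFiniteMeasure P] (hplay : IsSemiBanditPlay P 𝓖 σ n ℓ V) {t : ℕ}
    (ht : t < n) (i : Fin d) :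
    P[fun ω => V t ω i | 𝓖 t] =ᵐ[P] fun ω => meanAction σ ℓ V t ω i := by
  have hdecomp : (fun ω => V t ω i) =
      ∑ v ∈ S, v i • Set.indicator {ω | V t ω = v} fun _ => (1 : ℝ) := by
    funext ω
    rw [Finset.sum_apply, sum_eq_single_of_mem (V t ω) (hplay.action_mem t ht ω)]
    · simp
    · intro v _ hv
      simp [hv.symm]
  have hint (v : Fin d → ℝ) : Integrable (Set.indicator {ω | V t ω = v} fun _ => (1 : ℝ)) P :=
    (integrable_const 1).indicator (hplay.measurable_action ht (measurableSet_singleton v))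
  have hlaw : ∀ᵐ ω ∂P, ∀ v ∈ S,
      P[v i • Set.indicator {ω | V t ω = v} (fun _ => (1 : ℝ)) | 𝓖 t] ω =
        v i * σ.prob t (semiBanditHistory ℓ V t ω) v := by
    refine (ae_ball_iff S.countable_toSet).2 fun v hv => ?_
    filter_upwards [condExp_smul (v i) (Set.indicator {ω | V t ω = v} fun _ => (1 : ℝ)) (𝓖 t)
      (μ := P), hplay.action_law t ht v hv] with ω hsmul hω
    rw [hsmul, Pi.smul_apply, hω, smul_eq_mul]
  rw [hdecomp]
  filter_upwards [condExp_finsetSum (fun v (_ : v ∈ S) => (hint v).smul (v i)) (𝓖 t), hlaw]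
    with ω hsum hω
  rw [hsum, Finset.sum_apply, sum_congr rfl hω]
  exact sum_congr rfl fun v _ => mul_comm _ _

variable {t : ℕ} {ω : Ω}

theorem lossEstimate_apply (hplay : IsSemiBanditPlay P 𝓖 σ n ℓ V)
    (h01 : ∀ v ∈ S, ∀ i, v i = 0 ∨ v i = 1) (ht : t < n) (ω : Ω) (i : Fin d) :
    lossEstimate σ ℓ V t ω i = ℓ t ω i * (V t ω i / meanAction σ ℓ V t ω i) :=
  semiBanditEstimate_semiBanditObs _ _ (h01 _ (hplay.action_mem t ht ω) i)

theorem action_nonneg (hplay : IsSemiBanditPlay P 𝓖 σ n ℓ V)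
    (h01 : ∀ v ∈ S, ∀ i, v i = 0 ∨ v i = 1) (ht : t < n) (ω : Ω) (i : Fin d) : 0 ≤ V t ω i :=
  nonneg_of_eq_zero_or_eq_one (h01 _ (hplay.action_mem t ht ω) i)

theorem lossEstimate_dotProduct_meanAction (hplay : IsSemiBanditPlay P 𝓖 σ n ℓ V)
    (h01 : ∀ v ∈ S, ∀ i, v i = 0 ∨ v i = 1) (ht : t < n)
    (hw : ∀ i, meanAction σ ℓ V t ω i ≠ 0) :
    lossEstimate σ ℓ V t ω ⬝ᵥ meanAction σ ℓ V t ω = ℓ t ω ⬝ᵥ V t ω :=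
  sum_congr rfl fun i _ => by
    rw [hplay.lossEstimate_apply h01 ht, mul_assoc, div_mul_cancel₀ _ (hw i)]

theorem meanAction_mul_lossEstimate_sq (hplay : IsSemiBanditPlay P 𝓖 σ n ℓ V)
    (h01 : ∀ v ∈ S, ∀ i, v i = 0 ∨ v i = 1) (ht : t < n) {i : Fin d}
    (hw : meanAction σ ℓ V t ω i ≠ 0) :
    meanAction σ ℓ V t ω i * lossEstimate σ ℓ V t ω i ^ 2 =
      ℓ t ω i ^ 2 * (V t ω i / meanAction σ ℓ V t ω i) := by
  rw [hplay.lossEstimate_apply h01 ht]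
  rcases h01 _ (hplay.action_mem t ht ω) i with h | h
  · simp [h]
  · rw [h]
    field_simp

theorem sum_loss_dotProduct_action_le (hplay : IsSemiBanditPlay P 𝓖 σ n ℓ V)
    (hσ : IsSemiBanditLinexp η w₁ n σ) (h01 : ∀ v ∈ S, ∀ i, v i = 0 ∨ v i = 1) (hη : 0 < η)
    (hw₁ : ∀ i, 0 < w₁ i) (hn : 1 ≤ n) {v : Fin d → ℝ} (hv : v ∈ S) (ω : Ω) :
    ∑ t ∈ range n, ℓ t ω ⬝ᵥ V t ω ≤
      ∑ t ∈ range n, lossEstimate σ ℓ V t ω ⬝ᵥ v + bregman (linexpPotential η) v w₁ +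
        η / 2 * ∑ t ∈ range n, ∑ i, meanAction σ ℓ V t ω i * lossEstimate σ ℓ V t ω i ^ 2 := by
  have hwpos (t : ℕ) (ht : t < n) := hplay.meanAction_pos hσ hw₁ ht ω
  have hv0 (i : Fin d) : 0 ≤ v i := nonneg_of_eq_zero_or_eq_one (h01 v hv i)
  have hestimate (t : ℕ) (ht : t < n) (i : Fin d) : 0 ≤ lossEstimate σ ℓ V t ω i := by
    rw [hplay.lossEstimate_apply h01 ht]
    exact mul_nonneg (hplay.loss_nonneg t ht ω i)
      (div_nonneg (hplay.action_nonneg h01 ht ω i) (hwpos t ht i).le)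
  have hregret := sum_dotProduct_sub_le_of_linexp hη hv0 hn hwpos hestimate
    fun t ht => hσ.bregman_mean_succ_le hη hw₁ ht (hplay.isAdmissibleHistory ht.le ω) hv hv0
  have hsplit : ∑ t ∈ range n, lossEstimate σ ℓ V t ω ⬝ᵥ (meanAction σ ℓ V t ω - v) =
      ∑ t ∈ range n, ℓ t ω ⬝ᵥ V t ω - ∑ t ∈ range n, lossEstimate σ ℓ V t ω ⬝ᵥ v := by
    rw [← sum_sub_distrib]
    refine sum_congr rfl fun t ht => ?_
    rw [dotProduct_sub, hplay.lossEstimate_dotProduct_meanAction h01 (mem_range.1 ht)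
      fun i => (hwpos t (mem_range.1 ht) i).ne']
  have hstart : meanAction σ ℓ V 0 ω = w₁ := hσ.1 _
  rw [hsplit, hstart] at hregret
  linarith

theorem integrable_and_integral_mul_action_div_meanAction [IsFiniteMeasure P]
    (hplay : IsSemiBanditPlay P 𝓖 σ n ℓ V) (h01 : ∀ v ∈ S, ∀ i, v i = 0 ∨ v i = 1) (ht : t < n)
    {i : Fin d} (hw : ∀ ω, meanAction σ ℓ V t ω i ≠ 0) {g : Ω → ℝ} (hg : Measurable[𝓖 t] g)
    (hgint : Integrable g P) :
    Integrable (fun ω => g ω * (V t ω i / meanAction σ ℓ V t ω i)) P ∧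
      ∫ ω, g ω * (V t ω i / meanAction σ ℓ V t ω i) ∂P = ∫ ω, g ω ∂P := by
  have hV : Integrable (fun ω => V t ω i) P := by
    refine .of_bound ((measurable_pi_apply i).comp
      (hplay.measurable_action ht)).aestronglyMeasurable 1 (ae_of_all P fun ω => ?_)
    rcases h01 _ (hplay.action_mem t ht ω) i with h | h <;> simp [h]
  exact integrable_and_integral_mul_div_condExp (𝓖.le t) hV
    (ae_of_all P fun ω => hplay.action_nonneg h01 ht ω i) (hplay.condExp_action ht i)
    (ae_of_all P hw) hg.stronglyMeasurable hgint

theorem integrable_and_integral_lossEstimate_dotProduct [IsFiniteMeasure P]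
    (hplay : IsSemiBanditPlay P 𝓖 σ n ℓ V) (h01 : ∀ v ∈ S, ∀ i, v i = 0 ∨ v i = 1) (ht : t < n)
    (hw : ∀ ω i, meanAction σ ℓ V t ω i ≠ 0) (hℓ : ∀ i, Integrable (fun ω => ℓ t ω i) P)
    (v : Fin d → ℝ) :
    Integrable (fun ω => lossEstimate σ ℓ V t ω ⬝ᵥ v) P ∧
      ∫ ω, lossEstimate σ ℓ V t ω ⬝ᵥ v ∂P = ∫ ω, ℓ t ω ⬝ᵥ v ∂P := by
  have hcoord (i : Fin d) := hplay.integrable_and_integral_mul_action_div_meanAction h01 ht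
    (fun ω => hw ω i) (g := fun ω => ℓ t ω i)
    ((measurable_pi_apply i).comp (hplay.loss_measurable t ht)) (hℓ i)
  simp only [dotProduct, hplay.lossEstimate_apply h01 ht]
  have hint (i : Fin d) := (hcoord i).1.mul_const (v i)
  refine ⟨integrable_finsetSum _ fun i _ => hint i, ?_⟩
  rw [integral_finsetSum _ fun i _ => hint i,
    integral_finsetSum _ fun i _ => (hℓ i).mul_const (v i)]
  refine sum_congr rfl fun i _ => ?_
  rw [integral_mul_const, integral_mul_const, (hcoord i).2]

theorem integrable_and_integral_sum_meanAction_mul_lossEstimate_sq [IsFiniteMeasure P]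
    (hplay : IsSemiBanditPlay P 𝓖 σ n ℓ V) (h01 : ∀ v ∈ S, ∀ i, v i = 0 ∨ v i = 1) (ht : t < n)
    (hw : ∀ ω i, meanAction σ ℓ V t ω i ≠ 0) (hℓ : ∀ i, MemLp (fun ω => ℓ t ω i) 2 P) :
    Integrable (fun ω => ∑ i, meanAction σ ℓ V t ω i * lossEstimate σ ℓ V t ω i ^ 2) P ∧
      ∫ ω, ∑ i, meanAction σ ℓ V t ω i * lossEstimate σ ℓ V t ω i ^ 2 ∂P =
        ∫ ω, ∑ i, ℓ t ω i ^ 2 ∂P := by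
  have hcoord (i : Fin d) := hplay.integrable_and_integral_mul_action_div_meanAction h01 ht
    (fun ω => hw ω i) (g := fun ω => ℓ t ω i ^ 2)
    (((measurable_pi_apply i).comp (hplay.loss_measurable t ht)).pow_const 2) (hℓ i).integrable_sq
  simp only [fun ω i => hplay.meanAction_mul_lossEstimate_sq h01 ht (hw ω i)]
  refine ⟨integrable_finsetSum _ fun i _ => (hcoord i).1, ?_⟩
  rw [integral_finsetSum _ fun i _ => (hcoord i).1,
    integral_finsetSum _ fun i _ => (hℓ i).integrable_sq]
  exact sum_congr rfl fun i _ => (hcoord i).2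

theorem integral_loss_sub_le [IsProbabilityMeasure P] (hplay : IsSemiBanditPlay P 𝓖 σ n ℓ V)
    (hσ : IsSemiBanditLinexp η w₁ n σ) (h01 : ∀ v ∈ S, ∀ i, v i = 0 ∨ v i = 1) (hη : 0 < η)
    (hw₁ : ∀ i, 0 < w₁ i) (hn : 1 ≤ n) (hℓ : ∀ t < n, ∀ i, MemLp (fun ω => ℓ t ω i) 2 P)
    {v : Fin d → ℝ} (hv : v ∈ S) :
    ∫ ω, ∑ t ∈ range n, ℓ t ω ⬝ᵥ V t ω ∂P ≤ ∫ ω, ∑ t ∈ range n, ℓ t ω ⬝ᵥ v ∂P +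
      bregman (linexpPotential η) v w₁ + η / 2 * ∑ t ∈ range n, ∫ ω, ∑ i, ℓ t ω i ^ 2 ∂P := by
  have hw (t : ℕ) (ht : t < n) (ω : Ω) (i : Fin d) : meanAction σ ℓ V t ω i ≠ 0 :=
    (hplay.meanAction_pos hσ hw₁ ht ω i).ne'
  have hℓint (t : ℕ) (ht : t < n) (i : Fin d) : Integrable (fun ω => ℓ t ω i) P :=
    (hℓ t ht i).integrable one_le_two
  have hfirst (t : ℕ) (ht : t ∈ range n) :=
    hplay.integrable_and_integral_lossEstimate_dotProduct h01 (mem_range.1 ht)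
      (hw t (mem_range.1 ht)) (hℓint t (mem_range.1 ht)) v
  have hsecond (t : ℕ) (ht : t ∈ range n) :=
    hplay.integrable_and_integral_sum_meanAction_mul_lossEstimate_sq h01 (mem_range.1 ht)
      (hw t (mem_range.1 ht)) (hℓ t (mem_range.1 ht))
  have hint₁ := integrable_finsetSum _ fun t ht => (hfirst t ht).1
  have hint₂ := (integrable_finsetSum _ fun t ht => (hsecond t ht).1).const_mul (η / 2)
  have hloss : ∫ ω, ∑ t ∈ range n, ℓ t ω ⬝ᵥ v ∂P =
      ∑ t ∈ range n, ∫ ω, ℓ t ω ⬝ᵥ v ∂P := integral_finsetSum _ fun t ht =>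
    integrable_finsetSum _ fun i _ => (hℓint t (mem_range.1 ht) i).mul_const (v i)
  refine (integral_mono_of_nonneg (ae_of_all P fun ω => ?_)
    ((hint₁.add (integrable_const _)).add hint₂)
    (ae_of_all P (hplay.sum_loss_dotProduct_action_le hσ h01 hη hw₁ hn hv))).trans_eq ?_
  · exact sum_nonneg fun t ht => sum_nonneg fun i _ => mul_nonneg
      (hplay.loss_nonneg t (mem_range.1 ht) ω i) (hplay.action_nonneg h01 (mem_range.1 ht) ω i)
  · rw [integral_add' (hint₁.add (integrable_const _)) hint₂,
      integral_add' hint₁ (integrable_const _), integral_const, integral_const_mul,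
      integral_finsetSum _ fun t ht => (hfirst t ht).1,
      integral_finsetSum _ fun t ht => (hsecond t ht).1, hloss,
      sum_congr rfl fun t ht => (hfirst t ht).2, sum_congr rfl fun t ht => (hsecond t ht).2]
    simp

theorem expectedRegret_le [IsProbabilityMeasure P] (hplay : IsSemiBanditPlay P 𝓖 σ n ℓ V)
    (hσ : IsSemiBanditLinexp η w₁ n σ) (h01 : ∀ v ∈ S, ∀ i, v i = 0 ∨ v i = 1) (hη : 0 < η)
    (hw₁ : ∀ i, 0 < w₁ i) (hn : 1 ≤ n) {R B : ℝ}
    (hR : ∀ v ∈ S, bregman (linexpPotential η) v w₁ ≤ R)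
    (hB : ∀ t < n, ∀ ω, ∑ i, ℓ t ω i ^ 2 ≤ B) :
    expectedRegret P S n ℓ V ≤ R + η / 2 * (n * B) := by
  have hℓ (t : ℕ) (ht : t < n) (i : Fin d) : MemLp (fun ω => ℓ t ω i) 2 P := by
    refine .of_bound (((measurable_pi_apply i).comp (hplay.loss_measurable t ht)).mono
      (𝓖.le t) le_rfl).aestronglyMeasurable √B (ae_of_all P fun ω => Real.abs_le_sqrt ?_)
    exact (single_le_sum (fun j _ => sq_nonneg (ℓ t ω j)) (mem_univ i)).trans (hB t ht ω)
  have hsq (t : ℕ) (ht : t ∈ range n) : ∫ ω, ∑ i, ℓ t ω i ^ 2 ∂P ≤ B :=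
    (integral_mono (integrable_finsetSum _ fun i _ => (hℓ t (mem_range.1 ht) i).integrable_sq)
      (integrable_const B) (hB t (mem_range.1 ht))).trans_eq (by simp)
  have hsum : ∑ t ∈ range n, ∫ ω, ∑ i, ℓ t ω i ^ 2 ∂P ≤ n * B := by
    simpa using sum_le_card_nsmul _ _ _ hsq
  have hcompare (v : Fin d → ℝ) (hv : v ∈ S) :
      ∫ ω, ∑ t ∈ range n, ℓ t ω ⬝ᵥ V t ω ∂P - (R + η / 2 * (n * B)) ≤
        ∫ ω, ∑ t ∈ range n, ℓ t ω ⬝ᵥ v ∂P := by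
    have hmean := hplay.integral_loss_sub_le hσ h01 hη hw₁ hn hℓ hv
    have hsecond := mul_le_mul_of_nonneg_left hsum (half_pos hη).le
    linarith [hR v hv]
  obtain ⟨ω₀⟩ := P.nonempty_of_neZero
  have : Nonempty {v // v ∈ S} := ⟨⟨V 0 ω₀, hplay.action_mem 0 hn ω₀⟩⟩
  rw [expectedRegret, sub_le_comm]
  exact le_ciInf fun v => hcompare v v.2

end IsSemiBanditPlay

theorem div_add_half_mul_sqrt_two_mul_div {a b : ℝ} (ha : 0 < a) (hb : 0 < b) :
    a / √(2 * a / b) + √(2 * a / b) / 2 * b = √(2 * a * b) := by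
  have hpos : 0 < √(2 * a / b) := Real.sqrt_pos.2 (by positivity)
  have hsq : √(2 * a / b) ^ 2 * b = 2 * a := by
    rw [Real.sq_sqrt (by positivity), div_mul_cancel₀ _ hb.ne']
  have hsqrt : √(2 * a * b) = √(2 * a / b) * b := by
    rw [Real.sqrt_eq_iff_mul_self_eq_of_pos (by positivity)]
    linear_combination b * hsq
  have hfirst : a / √(2 * a / b) = √(2 * a / b) / 2 * b := by
    rw [div_eq_iff hpos.ne']
    linarith
  rw [hsqrt, hfirst]
  ring

theorem IsAlmostSymmetric.expectedRegret_le {k : ℕ} (hS : IsAlmostSymmetric S k)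
    [IsProbabilityMeasure P] (hplay : IsSemiBanditPlay P 𝓖 σ n ℓ V) (hn : 1 ≤ n) {L B : ℝ}
    (hL : L = max (Real.log (d / k)) 1) (hBpos : 0 < B)
    (hB : ∀ t < n, ∀ ω, ∑ i, ℓ t ω i ^ 2 ≤ B) (hη : η = √(2 * k * L / (n * B)))
    (hw₁ : IsArgmin (fun w => bregman (linexpPotential η) w (fun _ => (k : ℝ) / (d : ℝ)))
      (convexHull ℝ (S : Set (Fin d → ℝ))) w₁)
    (hσ : IsSemiBanditLinexp η w₁ n σ) :
    expectedRegret P S n ℓ V ≤ √(2 * k * n * B * L) := by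
  have hradius : 0 < k * L :=
    mul_pos (by exact_mod_cast hS.2.1) (one_pos.trans_le (hL ▸ le_max_right _ _))
  have hvariance : 0 < n * B := mul_pos (by exact_mod_cast hn) hBpos
  rw [mul_assoc 2] at hη
  have hηpos : 0 < η := hη ▸ Real.sqrt_pos.2 (div_pos (mul_pos two_pos hradius) hvariance)
  calc expectedRegret P S n ℓ V ≤ k * L / η + η / 2 * (n * B) :=
        hplay.expectedRegret_le hσ hS.1 hηpos (hS.argmin_pos hηpos hw₁) hn
          (fun v hv => hL ▸ hS.bregman_argmin_le hηpos hw₁ hv) hB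
    _ = √(2 * (k * L) * (n * B)) := by
        rw [hη, div_add_half_mul_sqrt_two_mul_div hradius hvariance]
    _ = √(2 * k * n * B * L) := by ring_nf

end Play

theorem sum_sq_le_card_of_norm_le_one {ι : Type*} [Fintype ι] {l : ι → ℝ} (hl : ‖l‖ ≤ 1) :
    ∑ i, l i ^ 2 ≤ Fintype.card ι := by
  have hcoord (i : ι) (_ : i ∈ univ) : l i ^ 2 ≤ 1 :=
    (sq_le_one_iff_abs_le_one _).2 ((norm_le_pi_norm l i).trans hl)
  simpa using sum_le_card_nsmul _ _ _ hcoord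

theorem mainTheorem6 {d k n : ℕ} (hn : 1 ≤ n) (S : Finset (Fin d → ℝ))
    (hS : IsAlmostSymmetric S k) (L : ℝ) (hL : L = max (Real.log ((d : ℝ) / (k : ℝ))) 1)
    {Ω : Type*} {mΩ : MeasurableSpace Ω} (P : Measure Ω) [IsProbabilityMeasure P]
    (𝓖 : Filtration ℕ mΩ) (σ : SemiBanditForecaster S) (ℓ V : ℕ → Ω → Fin d → ℝ)
    (hplay : IsSemiBanditPlay P 𝓖 σ n ℓ V) :
    (∀ (η : ℝ) (w₁ : Fin d → ℝ),
      η = √(2 * (k : ℝ) * L / ((n : ℝ) * (d : ℝ))) →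
      IsArgmin (fun w => bregman (linexpPotential η) w (fun _ => (k : ℝ) / (d : ℝ)))
        (convexHull ℝ (S : Set (Fin d → ℝ))) w₁ →
      IsSemiBanditLinexp η w₁ n σ →
      LInftyAssumption n ℓ →
      expectedRegret P S n ℓ V ≤ √(2 * (k : ℝ) * (n : ℝ) * (d : ℝ) * L)) ∧
    (∀ (η : ℝ) (w₁ : Fin d → ℝ),
      η = (k : ℝ) * √(L / ((n : ℝ) * (d : ℝ))) →
      IsArgmin (fun w => bregman (linexpPotential η) w (fun _ => (k : ℝ) / (d : ℝ)))
        (convexHull ℝ (S : Set (Fin d → ℝ))) w₁ →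
      IsSemiBanditLinexp η w₁ n σ →
      LTwoAssumption S n ℓ →
      expectedRegret P S n ℓ V ≤ 2 * √((n : ℝ) * (d : ℝ) * L)) := by
  have hk : (0 : ℝ) < k := by exact_mod_cast hS.2.1
  have hd : (0 : ℝ) < d := by exact_mod_cast hS.2.1.trans hS.2.2.1
  refine ⟨fun η w₁ hη hw₁ hσ hℓ => ?_, fun η w₁ hη hw₁ hσ hℓ => ?_⟩
  · have hsq (t : ℕ) (ht : t < n) (ω : Ω) : ∑ i, ℓ t ω i ^ 2 ≤ d := by
      simpa using sum_sq_le_card_of_norm_le_one (hℓ t ht ω)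
    exact hS.expectedRegret_le hplay hn hL hd hsq hη hw₁ hσ
  · have hsq (t : ℕ) (ht : t < n) (ω : Ω) : ∑ i, ℓ t ω i ^ 2 ≤ 2 * d / k :=
      hS.sum_sq_loss_le (hplay.loss_nonneg t ht ω) (hℓ t ht ω)
    have hrate : k * √(L / (n * d)) = √(2 * k * L / (n * (2 * d / k))) := by
      rw [← Real.sqrt_sq hk.le, ← Real.sqrt_mul (sq_nonneg _), Real.sqrt_sq hk.le]
      field_simp
    have hbound : √(2 * k * n * (2 * d / k) * L) = 2 * √(n * d * L) := by
      rw [← Real.sqrt_sq zero_le_two, ← Real.sqrt_mul (sq_nonneg _), Real.sqrt_sq zero_le_two]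
      field_simp
    exact hbound ▸ hS.expectedRegret_le hplay hn hL (by positivity) hsq (hη.trans hrate) hw₁ hσ
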